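/- For $n\ge 1$ let $\pi_n$ be a permutation chosen uniformly at random from the symmetric group $\mathcal S_n$, all $\pi_n$ being defined on a common probability space. Let $$D_n=\#\{1\le k\le n-1:\ \pi_n(k)>\pi_n(k+1)\},\qquad D_n'=\#\{1\le k\le n-1:\ \pi_n^{-1}(k)>\pi_n^{-1}(k+1)\}$$ be the numbers of descents of $\pi_n$ and of its inverse $\pi_n^{-1}$, and put $T_n=D_n+D_n'$. For $t\in\mathbb R$ let $L(t)=\log\frac{e^t-1}{t}$ if $t\neq 0$ and $L(0)=0$, and for $x,y\in\mathbb R$ let $$I(x)=\sup_{t\in\mathbb R}\{xt-L(t)\}\in[0,+\infty],\qquad J(y)=\inf_{x\in\mathbb R}\{I(x)+I(y-x)\}\in[0,+\infty].$$ Then the sequence $(T_n/n)_{n\ge 1}$ satisfies a large deviation principle with speed $n$ and good rate function $J$. That is, $J$ is a lower semicontinuous function with values in $[0,+\infty]$, for every $a\in\mathbb R$ the set $\{y\in\mathbb R: J(y)\le a\}$ is compact, and for every Borel set $B\subset\mathbb R$, with interior $B^\circ$ and closure $\overline B$, $$-\inf_{y\in B^\circ}J(y)\ \le\ \liminf_{n\to\infty}\frac1n\log\mathbb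 P\Big(\frac{T_n}{n}\in B\Big)\ \le\ \limsup_{n\to\infty}\frac1n\log\mathbb P\Big(\frac{T_n}{n}\in B\Big)\ \le\ -\inf_{y\in\overline B}J(y),$$ with the conventions $\log 0=-\infty$ and $\inf\emptyset=+\infty$. -/

import Mathlib

open MeasureTheory Filter Topology

open scoped ENNReal

namespace DescentLDP

/-- The number of descents of a permutation `σ` of `{0, …, n - 1}`: the number of positions `k`
such that `k + 1` is still a position and `σ (k + 1) < σ k`. -/
def descents {n : ℕ} (σ : Equiv.Perm (Fin n)) : ℕ :=
  (Finset.univ.filter fun k : Fin n => ∃ h : (k : ℕ) + 1 < n, σ ⟨(k : ℕ) + 1, h⟩ < σ k).card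

/-- `T = D + D'`: the number of descents of `σ` plus the number of descents of `σ⁻¹`. -/
def twoSidedDescents {n : ℕ} (σ : Equiv.Perm (Fin n)) : ℕ :=
  descents σ + descents σ⁻¹

/-- `π` is a random permutation of `n` points (a measurable map into the finite discrete space
of permutations) which is uniformly distributed under `P`. -/
def IsUniformPermutation {Ω : Type*} [MeasurableSpace Ω] (P : Measure Ω) {n : ℕ}
    (π : Ω → Equiv.Perm (Fin n)) : Prop :=
  ∀ σ : Equiv.Perm (Fin n),
    MeasurableSet (π ⁻¹' {σ}) ∧ P (π ⁻¹' {σ}) = ((Nat.factorial n : ℕ) : ℝ≥0∞)⁻¹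

/-- `L t = log ((exp t - 1) / t)`, with the value `L 0 = 0` given by continuity. -/
noncomputable def L (t : ℝ) : ℝ :=
  if t = 0 then 0 else Real.log ((Real.exp t - 1) / t)

/-- `I x = sup_t (x t - L t)`, the Fenchel-Legendre transform of `L`, with values in the
extended reals (it takes the value `+∞`, and it is nonnegative because of the term `t = 0`). -/
noncomputable def I (x : ℝ) : EReal :=
  ⨆ t : ℝ, ((x * t - L t : ℝ) : EReal)

/-- `J y = inf_x (I x + I (y - x))`. -/
noncomputable def J (y : ℝ) : EReal :=
  ⨅ x : ℝ, (I x + I (y - x))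

/-- A good rate function: a lower semicontinuous function with values in `[0, +∞]` all of whose
sublevel sets are compact. -/
structure IsGoodRateFunction {X : Type*} [TopologicalSpace X] (R : X → EReal) : Prop where
  nonneg : ∀ x, 0 ≤ R x
  lowerSemicontinuous : LowerSemicontinuous R
  isCompact_sublevel : ∀ a : ℝ, IsCompact {x | R x ≤ (a : EReal)}

/-- The sequence of random variables `Z n` satisfies, under `P`, the large deviation principle
with speed `n` and rate function `R`: for every Borel set `B`,
`- inf_{interior B} R ≤ liminf (1/n) log P (Z n ∈ B)` and
`limsup (1/n) log P (Z n ∈ B) ≤ - inf_{closure B} R`, where `log 0 = -∞` and the infimum over the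
empty set is `+∞`. -/
structure SatisfiesLDP {Ω X : Type*} [MeasurableSpace Ω] [TopologicalSpace X] [MeasurableSpace X]
    [BorelSpace X] (P : Measure Ω) (Z : ℕ → Ω → X) (R : X → EReal) : Prop where
  measurable : ∀ n, Measurable (Z n)
  lower : ∀ B : Set X, MeasurableSet B →
    -(⨅ x ∈ interior B, R x) ≤
      liminf (fun n : ℕ => (((n : ℝ)⁻¹ : ℝ) : EReal) * ENNReal.log (P (Z n ⁻¹' B))) atTop
  upper : ∀ B : Set X, MeasurableSet B →
    limsup (fun n : ℕ => (((n : ℝ)⁻¹ : ℝ) : EReal) * ENNReal.log (P (Z n ⁻¹' B))) atTop ≤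
      -(⨅ x ∈ closure B, R x)

end DescentLDP

/-!
The theorem follows the Gärtner–Ellis scheme, once the exponential moments of
`T = twoSidedDescents` are known to satisfy `(1/n) log E[exp (t T_n)] → 2 L t`.

*Moments.* A word `a : Fin n → Fin k` is compatible with `σ` if it is weakly increasing, and
strictly increasing at the descents of `σ`; subtracting the number of descents passed so far shows
that there are `multichoose (k - descents σ) n` of them. Stably sorting the second coordinate of a
lexicographically increasing word of pairs decomposes it uniquely into a permutation `σ`, a word
compatible with `σ` and a word compatible with `σ⁻¹`. Hence
`∑ σ, multichoose (k - descents σ) n * multichoose (l - descents σ⁻¹) n = multichoose (k l) n`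
(`card_compatibleWords`, `sum_card_compatibleWords_mul`), and
summing against `s ^ (k + l)` gives (`hasSum_bivariate`)
`∑ σ, s ^ (T σ + 2) = (1 - s) ^ (2 n + 2) ∑ k l, s ^ (k + l) multichoose (k l) n`.
With `s = exp (-λ)`, `λ > 0`, the right-hand side is asymptotically a product: from below
`multichoose (k l) n ≥ (k l) ^ n / n!`, and from above
`multichoose (k l) n ≤ (k l + n) ^ n / n! ≤ (k + √n) ^ n (l + √n) ^ n / n!`, the cost of the shift by
`√n` being only `exp (O(√n))`. This gives the limit `2 L (-λ)`; for positive arguments the reversal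
`T ↦ 2 (n - 1) - T` is used.

*From moments to the large deviation principle.* The function `J` is the Legendre transform of
`2 L` (`J_eq_iSup`), which yields that it is a good rate function. The upper bound is Markov's
inequality on half-lines and a finite covering of a compact set (`expGrowthSup_measure_le`). The
lower bound at `y` is exponential tilting at a point `t` with `2 L' t = y`
(`le_expGrowthInf_measure`); such a point exists for every `y` in `(0, 2)`, as a minimizer of
`2 L t - y t`, and `J = ⊤` outside `(0, 2)`.
-/

namespace DescentLDP

/-! ### Words compatible with a permutation -/

/-- Increasing words of length `n` are multisets of size `n`, listed in order. -/
theorem card_monotone_eq_multichoose (n : ℕ) (α : Type*) [LinearOrder α] [Fintype α] :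
    Fintype.card {f : Fin n → α // Monotone f} = (Fintype.card α).multichoose n := by
  classical
  rw [← Sym.card_sym_eq_multichoose α n]
  let F : {f : Fin n → α // Monotone f} → Sym α n :=
    fun f => ⟨(List.ofFn f.1 : Multiset α), by simp⟩
  refine Fintype.card_of_bijective (f := F) ⟨fun f g h => ?_, fun m => ?_⟩
  · have h' : (List.ofFn f.1 : Multiset α) = List.ofFn g.1 := congrArg Subtype.val h
    have hp := Multiset.coe_eq_coe.1 h'
    exact Subtype.ext (List.ofFn_injective
      (hp.eq_of_pairwise' f.2.sortedLE_ofFn.pairwise g.2.sortedLE_ofFn.pairwise))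
  · obtain ⟨m, hm⟩ := m
    have hl : (m.sort (· ≤ ·)).length = n := by simp [hm]
    subst hl
    refine ⟨⟨(m.sort (· ≤ ·)).get,
      List.SortedLE.monotone_get (m.pairwise_sort (· ≤ ·)).sortedLE⟩, ?_⟩
    apply Subtype.ext
    change ((List.ofFn (m.sort (· ≤ ·)).get : List α) : Multiset α) = m
    rw [List.ofFn_get, Multiset.sort_eq]

/-- The words with letters in `Fin k` that are weakly increasing, and strictly increasing at the
descents of `σ`. Both conditions are encoded by strict monotonicity of `i ↦ (a i, σ i)` in the
lexicographic order. -/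
def compatibleWords {n : ℕ} (σ : Equiv.Perm (Fin n)) (k : ℕ) : Finset (Fin n → Fin k) :=
  Finset.univ.filter fun a => StrictMono fun i => toLex (a i, σ i)

theorem mem_compatibleWords {n k : ℕ} {σ : Equiv.Perm (Fin n)} {a : Fin n → Fin k} :
    a ∈ compatibleWords σ k ↔ StrictMono fun i => toLex (a i, σ i) := by
  simp [compatibleWords]

/-- The condition characterizes `σ⁻¹` as the stable sorting permutation of `c`. -/
theorem inv_eq_sort_iff {n l : ℕ} {σ : Equiv.Perm (Fin n)} {c : Fin n → Fin l} :
    σ⁻¹ = Tuple.sort c ↔ c ∘ ⇑σ⁻¹ ∈ compatibleWords σ⁻¹ l := by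
  rw [Tuple.eq_sort_iff', mem_compatibleWords]
  rfl

/-- If `σ⁻¹` stably sorts `c`, then `σ i < σ j` means `c i < c j`, or `c i = c j` and `i < j`.
Hence a word of pairs with second coordinate `c` is lexicographically increasing exactly when its
first coordinate is compatible with `σ`. -/
theorem monotone_toLex_iff {n k l : ℕ} {σ : Equiv.Perm (Fin n)} {a : Fin n → Fin k}
    {c : Fin n → Fin l} (hc : c ∘ ⇑σ⁻¹ ∈ compatibleWords σ⁻¹ l) :
    Monotone (fun i => toLex (a i, c i)) ↔ a ∈ compatibleWords σ k := by
  rw [mem_compatibleWords] at hc ⊢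
  have hσ : ∀ i j, σ i < σ j ↔ (c i < c j ∨ c i = c j ∧ i < j) := fun i j => by
    rw [← hc.lt_iff_lt, Prod.Lex.toLex_lt_toLex]
    simp
  have key : ∀ i j, i < j → (toLex (a i, c i) ≤ toLex (a j, c j) ↔
      toLex (a i, σ i) < toLex (a j, σ j)) := fun i j hij => by
    rw [Prod.Lex.toLex_le_toLex, Prod.Lex.toLex_lt_toLex]
    simp only [hσ, hij, and_true, le_iff_lt_or_eq]
  rw [monotone_iff_forall_lt]
  exact forall₂_congr fun i j => forall_congr' fun hij => key i j hij

/-- Both sides count the lexicographically increasing words of length `n` in `Fin k ×ₗ Fin l`; on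
the left they are sorted by the permutation that stably sorts the second coordinate. -/
theorem sum_card_compatibleWords_mul (n k l : ℕ) :
    ∑ σ : Equiv.Perm (Fin n), (compatibleWords σ k).card * (compatibleWords σ⁻¹ l).card =
      (k * l).multichoose n := by
  classical
  have h := card_monotone_eq_multichoose n (Fin k ×ₗ Fin l)
  have hcard : Fintype.card (Fin k ×ₗ Fin l) = k * l := by
    rw [show Fintype.card (Fin k ×ₗ Fin l) = Fintype.card (Fin k × Fin l) from rfl]
    simp
  rw [hcard, Fintype.card_subtype] at h
  rw [← h, Finset.card_eq_sum_card_fiberwise (t := Finset.univ)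
    (f := fun f : Fin n → Fin k ×ₗ Fin l => (Tuple.sort fun i => (ofLex (f i)).2)⁻¹)
    (by intro _ _; simp)]
  refine Finset.sum_congr rfl fun σ _ => ?_
  rw [← Finset.card_product]
  symm
  refine Finset.card_nbij' (fun f => (fun i => (ofLex (f i)).1, fun i => (ofLex (f (σ⁻¹ i))).2))
    (fun p i => toLex (p.1 i, p.2 (σ i))) ?_ ?_ ?_ ?_
  · intro f hf
    simp only [Finset.coe_filter, Finset.mem_filter, Finset.mem_univ, true_and,
      Set.mem_ofPred_eq] at hf
    have hc := inv_eq_sort_iff.1 (inv_eq_iff_eq_inv.1 hf.2).symm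
    simp only [Finset.coe_product, Set.mem_prod, Finset.mem_coe]
    exact ⟨(monotone_toLex_iff hc).1 hf.1, hc⟩
  · rintro ⟨a, b⟩ hp
    simp only [Finset.coe_product, Set.mem_prod, Finset.mem_coe] at hp
    have hc : (fun i => b (σ i)) ∘ ⇑σ⁻¹ ∈ compatibleWords σ⁻¹ l := by
      convert hp.2 using 1
      funext i
      simp
    simp only [Finset.coe_filter, Finset.mem_filter, Finset.mem_univ, true_and,
      Set.mem_ofPred_eq]
    exact ⟨(monotone_toLex_iff hc).2 hp.1, inv_eq_iff_eq_inv.2 (inv_eq_sort_iff.2 hc).symm⟩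
  · intro f _
    funext i
    simp
  · rintro ⟨a, b⟩ _
    simp

/-- The number of descents of `σ` at positions strictly less than `i`. -/
def descentsBefore {n : ℕ} (σ : Equiv.Perm (Fin n)) (i : ℕ) : ℕ :=
  (Finset.univ.filter fun k : Fin n =>
    (k : ℕ) < i ∧ ∃ h : (k : ℕ) + 1 < n, σ ⟨(k : ℕ) + 1, h⟩ < σ k).card

theorem descentsBefore_zero {n : ℕ} (σ : Equiv.Perm (Fin n)) : descentsBefore σ 0 = 0 := by
  simp [descentsBefore]

theorem descentsBefore_succ {n : ℕ} (σ : Equiv.Perm (Fin n)) (i : ℕ) (h : i + 1 < n) :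
    descentsBefore σ (i + 1) = descentsBefore σ i +
      if σ ⟨i + 1, h⟩ < σ ⟨i, by omega⟩ then 1 else 0 := by
  unfold descentsBefore
  have : (Finset.univ.filter fun k : Fin n => (k : ℕ) < i + 1 ∧
      ∃ h : (k : ℕ) + 1 < n, σ ⟨(k : ℕ) + 1, h⟩ < σ k) =
      (Finset.univ.filter fun k : Fin n => (k : ℕ) < i ∧
      ∃ h : (k : ℕ) + 1 < n, σ ⟨(k : ℕ) + 1, h⟩ < σ k) ∪
      (if σ ⟨i + 1, h⟩ < σ ⟨i, by omega⟩ then {⟨i, by omega⟩} else ∅) := by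
    ext k
    obtain ⟨k, hk⟩ := k
    split_ifs with hd
    · simp only [Finset.mem_filter, Finset.mem_univ, true_and, Finset.mem_union,
        Finset.mem_singleton, Fin.mk.injEq]
      constructor
      · rintro ⟨h1, h2⟩
        rcases Nat.lt_succ_iff_lt_or_eq.1 h1 with h3 | h3
        · exact Or.inl ⟨h3, h2⟩
        · exact Or.inr h3
      · rintro (⟨h1, h2⟩ | rfl)
        · exact ⟨by omega, h2⟩
        · exact ⟨by omega, h, hd⟩
    · simp only [Finset.mem_filter, Finset.mem_univ, true_and, Finset.union_empty]
      constructor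
      · rintro ⟨h1, h2⟩
        rcases Nat.lt_succ_iff_lt_or_eq.1 h1 with h3 | rfl
        · exact ⟨h3, h2⟩
        · exact absurd h2.2 hd
      · rintro ⟨h1, h2⟩
        exact ⟨by omega, h2⟩
  rw [this, Finset.card_union_of_disjoint]
  · split_ifs <;> simp
  · split_ifs
    · simp
    · simp

theorem descentsBefore_last {n : ℕ} (σ : Equiv.Perm (Fin (n + 1))) :
    descentsBefore σ n = descents σ := by
  unfold descentsBefore descents
  congr 1
  ext k
  simp only [Finset.mem_filter, Finset.mem_univ, true_and, and_iff_right_iff_imp]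
  rintro ⟨h, -⟩
  omega

theorem descents_le {n : ℕ} (σ : Equiv.Perm (Fin n)) : descents σ ≤ n - 1 := by
  rcases n with _ | n
  · simp [descents]
  · rw [← descentsBefore_last]
    have : ∀ i, i ≤ n → descentsBefore σ i ≤ i := by
      intro i
      induction i with
      | zero => simp [descentsBefore_zero]
      | succ i ih =>
        intro hi
        rw [descentsBefore_succ σ i (by omega)]
        have := ih (by omega)
        split_ifs <;> omega
    simpa using this n le_rfl

/-- Compatibility only involves adjacent positions: the letter increases by at least `1` at a
descent, and does not decrease elsewhere. -/
theorem mem_compatibleWords_iff_succ {n k : ℕ} {σ : Equiv.Perm (Fin (n + 1))}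
    {a : Fin (n + 1) → Fin k} :
    a ∈ compatibleWords σ k ↔ ∀ i : Fin n,
      (a i.castSucc : ℕ) + (if σ i.succ < σ i.castSucc then 1 else 0) ≤ a i.succ := by
  rw [mem_compatibleWords, Fin.strictMono_iff_lt_succ]
  refine forall_congr' fun i => ?_
  have hne : σ i.castSucc ≠ σ i.succ := fun h => by
    simpa using Fin.castSucc_lt_succ.ne (σ.injective h)
  rw [Prod.Lex.toLex_lt_toLex]
  simp only [Fin.lt_def, Fin.ext_iff] at *
  split_ifs <;> omega

/-- Subtracting `descentsBefore σ i` from the `i`-th letter turns the words compatible with `σ` into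
the weakly increasing words over an alphabet with `descents σ` letters fewer. -/
theorem card_compatibleWords {n : ℕ} (σ : Equiv.Perm (Fin (n + 1))) (k : ℕ) :
    (compatibleWords σ k).card = (k - descents σ).multichoose (n + 1) := by
  classical
  have h := card_monotone_eq_multichoose (n + 1) (Fin (k - descents σ))
  rw [Fintype.card_fin, Fintype.card_subtype] at h
  rw [← h]
  have hd : ∀ i : Fin n, descentsBefore σ (i.succ : Fin (n + 1)) =
      descentsBefore σ (i.castSucc : Fin (n + 1)) +
        if σ i.succ < σ i.castSucc then 1 else 0 := fun i =>
    descentsBefore_succ σ i (by omega)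
  have hmono : ∀ a ∈ compatibleWords σ k,
      Monotone fun i : Fin (n + 1) => ((a i : ℕ) : ℤ) - descentsBefore σ i := by
    intro a ha
    rw [mem_compatibleWords_iff_succ] at ha
    refine Fin.monotone_iff_le_succ.2 fun i => ?_
    have h1 := ha i
    have h2 := hd i
    rw [h2]
    split_ifs at h1 ⊢ <;> push_cast <;> omega
  have hlow : ∀ a ∈ compatibleWords σ k, ∀ i, descentsBefore σ (i : Fin (n + 1)) ≤ a i := by
    intro a ha i
    have := hmono a ha (Fin.zero_le i)
    simp only [Fin.val_zero, descentsBefore_zero] at this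
    omega
  -- This also shows that there is no compatible word if `k ≤ descents σ`, where `k - descents σ`
  -- is truncated to `0`.
  have hup : ∀ a ∈ compatibleWords σ k, ∀ i : Fin (n + 1),
      (a i : ℕ) - descentsBefore σ i < k - descents σ := by
    intro a ha i
    have h1 := hmono a ha (Fin.le_last i)
    have h2 := hlow a ha i
    have h3 := hlow a ha (Fin.last n)
    have h4 := (a (Fin.last n)).2
    simp only [Fin.val_last, descentsBefore_last] at h1 h3
    omega
  refine Finset.card_bij (fun a ha i => ⟨(a i : ℕ) - descentsBefore σ i, hup a ha i⟩) ?_ ?_ ?_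
  · intro a ha
    simp only [Finset.mem_filter, Finset.mem_univ, true_and]
    intro i j hij
    have h1 := hmono a ha hij
    have h2 := hlow a ha i
    have h3 := hlow a ha j
    dsimp only at h1
    simp only [Fin.le_def]
    omega
  · intro a ha b hb hab
    funext i
    have h1 := congrArg Fin.val (congrFun hab i)
    have h2 := hlow a ha i
    have h3 := hlow b hb i
    dsimp only at h1
    exact Fin.ext (by omega)
  · intro b hb
    simp only [Finset.mem_filter, Finset.mem_univ, true_and] at hb
    have hle : ∀ i : Fin (n + 1), descentsBefore σ i ≤ descents σ := fun i => by
      have : Monotone fun i : Fin (n + 1) => descentsBefore σ i :=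
        Fin.monotone_iff_le_succ.2 fun i => by
          rw [hd i]
          exact Nat.le_add_right _ _
      simpa [descentsBefore_last] using this (Fin.le_last i)
    refine ⟨fun i => ⟨(b i : ℕ) + descentsBefore σ i, ?_⟩, ?_, ?_⟩
    · have := (b i).2
      have := hle i
      omega
    · rw [mem_compatibleWords_iff_succ]
      intro i
      have h1 : (b i.castSucc : ℕ) ≤ b i.succ := hb Fin.castSucc_lt_succ.le
      have h2 := hd i
      dsimp only
      omega
    · funext i
      exact Fin.ext (by simp)

/-! ### Exponential moments of the two-sided descent number -/

theorem descents_eq_card_succ {m : ℕ} (σ : Equiv.Perm (Fin (m + 1))) :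
    descents σ = (Finset.univ.filter fun j : Fin m => σ j.succ < σ j.castSucc).card := by
  symm
  refine Finset.card_bij (fun j _ => j.castSucc) ?_ ?_ ?_
  · intro j hj
    simp only [Finset.mem_filter, Finset.mem_univ, true_and] at hj ⊢
    exact ⟨by simp, hj⟩
  · intro i _ j _ h
    exact Fin.castSucc_injective _ h
  · intro k hk
    simp only [Finset.mem_filter, Finset.mem_univ, true_and] at hk
    obtain ⟨h, hk⟩ := hk
    refine ⟨⟨k, by omega⟩, ?_, rfl⟩
    simp only [Finset.mem_filter, Finset.mem_univ, true_and]
    exact hk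

theorem descents_revPerm_mul {m : ℕ} (σ : Equiv.Perm (Fin (m + 1))) :
    descents (Fin.revPerm * σ) = m - descents σ := by
  rw [descents_eq_card_succ, descents_eq_card_succ]
  have h := Finset.card_filter_add_card_filter_not (s := (Finset.univ : Finset (Fin m)))
    (fun j : Fin m => σ j.succ < σ j.castSucc)
  rw [Finset.card_univ, Fintype.card_fin] at h
  have h2 : (Finset.univ.filter fun j : Fin m =>
      ((Fin.revPerm * σ : Equiv.Perm (Fin (m + 1))) j.succ <
        (Fin.revPerm * σ : Equiv.Perm (Fin (m + 1))) j.castSucc)) =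
      Finset.univ.filter fun j : Fin m => ¬ σ j.succ < σ j.castSucc := by
    refine Finset.filter_congr fun j _ => ?_
    have hne : σ j.castSucc ≠ σ j.succ := fun h => Fin.castSucc_lt_succ.ne (σ.injective h)
    simp only [Equiv.Perm.mul_apply, Fin.revPerm_apply, Fin.rev_lt_rev, not_lt]
    exact ⟨le_of_lt, fun h => lt_of_le_of_ne h hne⟩
  rw [h2]
  omega

theorem descents_mul_revPerm {m : ℕ} (σ : Equiv.Perm (Fin (m + 1))) :
    descents (σ * Fin.revPerm) = m - descents σ := by
  rw [← descents_revPerm_mul, descents_eq_card_succ, descents_eq_card_succ]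
  refine Finset.card_bij (fun j _ => j.rev) ?_ ?_ ?_
  · intro j hj
    simp only [Finset.mem_filter, Finset.mem_univ, true_and, Equiv.Perm.mul_apply,
      Fin.revPerm_apply, Fin.rev_lt_rev] at hj ⊢
    simpa [Fin.rev_succ, Fin.rev_castSucc] using hj
  · intro i _ j _ h
    exact Fin.rev_injective h
  · intro j hj
    refine ⟨j.rev, ?_, Fin.rev_rev j⟩
    simp only [Finset.mem_filter, Finset.mem_univ, true_and, Equiv.Perm.mul_apply,
      Fin.revPerm_apply, Fin.rev_lt_rev] at hj ⊢
    simpa [Fin.rev_succ, Fin.rev_castSucc] using hj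

theorem twoSidedDescents_mul_revPerm {m : ℕ} (σ : Equiv.Perm (Fin (m + 1))) :
    twoSidedDescents (σ * Fin.revPerm) + twoSidedDescents σ = 2 * m := by
  have h1 := descents_le σ
  have h2 := descents_le σ⁻¹
  have h3 : (σ * Fin.revPerm)⁻¹ = Fin.revPerm * σ⁻¹ := by
    rw [mul_inv_rev]
    rfl
  simp only [twoSidedDescents]
  rw [h3, descents_mul_revPerm, descents_revPerm_mul]
  omega

/-- The exponential moment `E[exp (t T)]` of the number `T` of two-sided descents of a uniformly
distributed permutation of `n` points. -/
noncomputable def moment (n : ℕ) (t : ℝ) : ℝ :=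
  (∑ σ : Equiv.Perm (Fin n), Real.exp (t * twoSidedDescents σ)) / n.factorial

theorem moment_pos (n : ℕ) (t : ℝ) : 0 < moment n t :=
  div_pos (Finset.sum_pos (fun _ _ => Real.exp_pos _) Finset.univ_nonempty)
    (by exact_mod_cast n.factorial_pos)

theorem moment_zero (n : ℕ) : moment n 0 = 1 := by
  have : (n.factorial : ℝ) ≠ 0 := by exact_mod_cast n.factorial_ne_zero
  simp [moment, Fintype.card_perm, this]

/-- Reversing the permutation replaces `T` by `2 * m - T`. -/
theorem moment_neg (m : ℕ) (t : ℝ) :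
    moment (m + 1) t = Real.exp (2 * m * t) * moment (m + 1) (-t) := by
  unfold moment
  rw [mul_div_assoc', Finset.mul_sum, ← Equiv.sum_comp (Equiv.mulRight Fin.revPerm)]
  congr 1
  refine Finset.sum_congr rfl fun σ _ => ?_
  rw [← Real.exp_add]
  have h : (twoSidedDescents (σ * Fin.revPerm) : ℝ) + twoSidedDescents σ = 2 * m := by
    exact_mod_cast twoSidedDescents_mul_revPerm σ
  congr 1
  simp only [Equiv.coe_mulRight]
  linear_combination t * h

theorem hasSum_pow_mul_multichoose (m d : ℕ) {s : ℝ} (h0 : 0 < s) (h1 : s < 1) :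
    HasSum (fun k : ℕ => s ^ k * ((k - d).multichoose (m + 1) : ℝ))
      (s ^ (d + 1) / (1 - s) ^ (m + 2)) := by
  rw [← hasSum_nat_add_iff' (d + 1)]
  have hz : ∑ i ∈ Finset.range (d + 1), s ^ i * ((i - d).multichoose (m + 1) : ℝ) = 0 := by
    refine Finset.sum_eq_zero fun i hi => ?_
    have : i - d = 0 := by
      have := Finset.mem_range.1 hi
      omega
    simp [this]
  rw [hz, sub_zero]
  have h := (hasSum_choose_mul_geometric_of_norm_lt_one (𝕜 := ℝ) (m + 1)
    (r := s) (by rwa [Real.norm_of_nonneg h0.le])).mul_left (s ^ (d + 1))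
  rw [mul_one_div] at h
  have he : (fun j : ℕ => s ^ (j + (d + 1)) * ((j + (d + 1) - d).multichoose (m + 1) : ℝ)) =
      fun j : ℕ => s ^ (d + 1) * (((j + (m + 1)).choose (m + 1) : ℝ) * s ^ j) := by
    funext j
    rw [show j + (d + 1) - d = j + 1 by omega, Nat.multichoose_eq,
      show j + 1 + (m + 1) - 1 = j + (m + 1) by omega]
    ring
  rw [he]
  exact h

/-- The generating function of the identity `sum_card_compatibleWords_mul` with respect to the two
alphabet sizes. -/
theorem hasSum_bivariate (m : ℕ) {s : ℝ} (h0 : 0 < s) (h1 : s < 1) :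
    HasSum (fun p : ℕ × ℕ => s ^ p.1 * s ^ p.2 * ((p.1 * p.2).multichoose (m + 1) : ℝ))
      ((∑ σ : Equiv.Perm (Fin (m + 1)), s ^ twoSidedDescents σ) *
        (s ^ 2 / (1 - s) ^ (2 * (m + 2)))) := by
  have h : ∀ σ : Equiv.Perm (Fin (m + 1)), HasSum (fun p : ℕ × ℕ =>
      (s ^ p.1 * ((compatibleWords σ p.1).card : ℝ)) *
        (s ^ p.2 * ((compatibleWords σ⁻¹ p.2).card : ℝ)))
      (s ^ (descents σ + 1) / (1 - s) ^ (m + 2) *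
        (s ^ (descents σ⁻¹ + 1) / (1 - s) ^ (m + 2))) := by
    intro σ
    have ha := hasSum_pow_mul_multichoose m (descents σ) h0 h1
    have hb := hasSum_pow_mul_multichoose m (descents σ⁻¹) h0 h1
    simp only [card_compatibleWords]
    refine ha.mul hb (ha.summable.mul_of_nonneg hb.summable ?_ ?_)
    · exact fun k => by positivity
    · exact fun k => by positivity
  have h2 := hasSum_sum (s := Finset.univ) fun σ _ => h σ
  convert h2 using 1
  · funext p
    rw [← sum_card_compatibleWords_mul (m + 1) p.1 p.2]
    push_cast
    rw [Finset.mul_sum]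
    exact Finset.sum_congr rfl fun σ _ => by ring
  · rw [Finset.sum_mul]
    refine Finset.sum_congr rfl fun σ _ => ?_
    rw [twoSidedDescents]
    have : (1 - s) ≠ 0 := by linarith
    field_simp
    ring

theorem multichoose_le_pow_div (a n : ℕ) :
    (a.multichoose n : ℝ) ≤ ((a : ℝ) + n) ^ n / n.factorial := by
  rw [Nat.multichoose_eq]
  refine (Nat.choose_le_pow_div n (a + n - 1)).trans ?_
  gcongr
  exact_mod_cast Nat.sub_le _ _

theorem pow_div_le_multichoose (a n : ℕ) :
    (a : ℝ) ^ n / n.factorial ≤ (a.multichoose n : ℝ) := by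
  rw [Nat.multichoose_eq, div_le_iff₀ (by exact_mod_cast n.factorial_pos)]
  have := Nat.pow_succ_le_ascFactorial a n
  rw [Nat.ascFactorial_eq_factorial_mul_choose'] at this
  rw [mul_comm]
  exact_mod_cast this

theorem moment_neg_eq (n : ℕ) (lam : ℝ) :
    moment n (-lam) = (∑ σ : Equiv.Perm (Fin n), Real.exp (-lam) ^ twoSidedDescents σ) /
      n.factorial := by
  unfold moment
  congr 1
  refine Finset.sum_congr rfl fun σ _ => ?_
  rw [← Real.exp_nat_mul, mul_comm]

theorem moment_neg_eq_tsum (m : ℕ) {lam : ℝ} (hl : 0 < lam) :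
    moment (m + 1) (-lam) = (∑' p : ℕ × ℕ, Real.exp (-lam) ^ p.1 * Real.exp (-lam) ^ p.2 *
      ((p.1 * p.2).multichoose (m + 1) : ℝ)) / (m + 1).factorial *
      ((1 - Real.exp (-lam)) ^ (2 * (m + 2)) / Real.exp (-lam) ^ 2) := by
  have h1 : Real.exp (-lam) < 1 := Real.exp_lt_one_iff.2 (by linarith)
  have h0 := Real.exp_pos (-lam)
  rw [(hasSum_bivariate m h0 h1).tsum_eq, moment_neg_eq]
  have : 1 - Real.exp (-lam) ≠ 0 := by linarith
  field_simp

/-- The upper bound is of the right exponential order once `mu` tends to `lam`. The shift by `√n` is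
the point where `k * l + n ≤ (k + √n) * (l + √n)` separates the two summation variables. -/
theorem moment_neg_le {lam mu : ℝ} (hmu : 0 < mu) (hlt : mu < lam) (m : ℕ) :
    moment (m + 1) (-lam) ≤
      (1 - Real.exp (-(lam - mu)))⁻¹ ^ 2 * ((1 - Real.exp (-lam)) ^ 2 / Real.exp (-lam) ^ 2) *
      Real.exp (2 * mu * √(m + 1 : ℕ)) * ((1 - Real.exp (-lam)) / mu) ^ (2 * (m + 1)) := by
  have hl := hmu.trans hlt
  have h1 : Real.exp (-lam) < 1 := Real.exp_lt_one_iff.2 (by linarith)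
  have h0 := Real.exp_pos (-lam)
  have hr0 := Real.exp_pos (-(lam - mu))
  have hr1 : Real.exp (-(lam - mu)) < 1 := Real.exp_lt_one_iff.2 (by linarith)
  rw [moment_neg_eq_tsum m hl]
  set n := m + 1 with hn
  set s := Real.exp (-lam) with hs
  set r := Real.exp (-(lam - mu)) with hr
  have hf : (0 : ℝ) < n.factorial := by exact_mod_cast n.factorial_pos
  have hone : ∀ k : ℕ, s ^ k * ((k : ℝ) + √n) ^ n ≤
      n.factorial * Real.exp (mu * √n) / mu ^ n * r ^ k := by
    intro k
    have hx : (0 : ℝ) ≤ mu * (k + √n) := by positivity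
    have := Real.pow_div_factorial_le_exp _ hx n
    rw [div_le_iff₀ hf, mul_pow] at this
    have h3 : ((k : ℝ) + √n) ^ n ≤ Real.exp (mu * (k + √n)) * n.factorial / mu ^ n := by
      rw [le_div_iff₀ (by positivity)]
      linarith
    calc s ^ k * ((k : ℝ) + √n) ^ n
        ≤ s ^ k * (Real.exp (mu * (k + √n)) * n.factorial / mu ^ n) := by gcongr
      _ = n.factorial * Real.exp (mu * √n) / mu ^ n * r ^ k := by
        rw [hs, hr, ← Real.exp_nat_mul, ← Real.exp_nat_mul, mul_add, Real.exp_add,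
          show (k : ℝ) * -(lam - mu) = k * -lam + mu * k by ring, Real.exp_add]
        ring
  have hterm : ∀ p : ℕ × ℕ, s ^ p.1 * s ^ p.2 * ((p.1 * p.2).multichoose n : ℝ) ≤
      n.factorial * Real.exp (2 * mu * √n) / mu ^ (2 * n) * (r ^ p.1 * r ^ p.2) := by
    rintro ⟨k, l⟩
    dsimp only
    have hkl : (((k * l : ℕ) : ℝ) + n) ^ n ≤ ((k : ℝ) + √n) ^ n * ((l : ℝ) + √n) ^ n := by
      rw [← mul_pow]
      gcongr
      have := Real.mul_self_sqrt (Nat.cast_nonneg (α := ℝ) n)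
      push_cast
      nlinarith [mul_nonneg (Nat.cast_nonneg (α := ℝ) k) (Real.sqrt_nonneg n),
        mul_nonneg (Nat.cast_nonneg (α := ℝ) l) (Real.sqrt_nonneg n)]
    calc s ^ k * s ^ l * ((k * l).multichoose n : ℝ)
        ≤ s ^ k * s ^ l * (((k : ℝ) + √n) ^ n * ((l : ℝ) + √n) ^ n / n.factorial) := by
          gcongr
          exact (multichoose_le_pow_div _ _).trans (by gcongr)
      _ = (s ^ k * ((k : ℝ) + √n) ^ n) * (s ^ l * ((l : ℝ) + √n) ^ n) / n.factorial := by ring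
      _ ≤ (n.factorial * Real.exp (mu * √n) / mu ^ n * r ^ k) *
          (n.factorial * Real.exp (mu * √n) / mu ^ n * r ^ l) / n.factorial := by
          exact div_le_div_of_nonneg_right
            (mul_le_mul (hone k) (hone l) (by positivity) (by positivity)) hf.le
      _ = _ := by
        rw [show 2 * mu * √n = mu * √n + mu * √n by ring, Real.exp_add, mul_comm 2 n, pow_mul]
        field_simp
  have hg := hasSum_geometric_of_lt_one hr0.le hr1
  have hgg := (hg.mul hg (hg.summable.mul_of_nonneg hg.summable (fun k => by positivity)
    (fun k => by positivity))).mul_left (n.factorial * Real.exp (2 * mu * √n) / mu ^ (2 * n))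
  have hle := hasSum_le hterm (hasSum_bivariate m h0 h1).summable.hasSum hgg
  have h1s : 0 < 1 - s := by linarith
  have h1r : 0 < 1 - r := by linarith
  calc (∑' p : ℕ × ℕ, s ^ p.1 * s ^ p.2 * ((p.1 * p.2).multichoose n : ℝ)) / n.factorial *
        ((1 - s) ^ (2 * (m + 2)) / s ^ 2)
      ≤ n.factorial * Real.exp (2 * mu * √n) / mu ^ (2 * n) * ((1 - r)⁻¹ * (1 - r)⁻¹) /
        n.factorial * ((1 - s) ^ (2 * (m + 2)) / s ^ 2) := by gcongr
    _ = _ := by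
      rw [show 2 * (m + 2) = 2 * n + 2 by omega, div_pow, pow_add]
      field_simp

/-- The lower bound comes from the single term `k = l = ⌈n / lam⌉` of the series, near the maximum of
`k ^ n * exp (-lam * k)`, together with Stirling's upper bound for `n!`. -/
theorem le_moment_neg {lam : ℝ} (hl : 0 < lam) (m : ℕ) :
    Real.exp (-2 * lam - 2) * ((1 - Real.exp (-lam)) ^ 2 / Real.exp (-lam) ^ 2) / (m + 1 : ℕ) *
      ((1 - Real.exp (-lam)) / lam) ^ (2 * (m + 1)) ≤ moment (m + 1) (-lam) := by
  have h1 : Real.exp (-lam) < 1 := Real.exp_lt_one_iff.2 (by linarith)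
  have h0 := Real.exp_pos (-lam)
  rw [moment_neg_eq_tsum m hl]
  set n := m + 1 with hn
  set s := Real.exp (-lam) with hs
  have hf : (0 : ℝ) < n.factorial := by exact_mod_cast n.factorial_pos
  set k := ⌈(n : ℝ) / lam⌉₊
  have hk1 : (n : ℝ) / lam ≤ k := Nat.le_ceil _
  have hk2 : (k : ℝ) < n / lam + 1 := Nat.ceil_lt_add_one (by positivity)
  have hn0 : (0 : ℝ) < n := by exact_mod_cast Nat.succ_pos m
  have hstir : (n.factorial : ℝ) ≤ Real.exp 1 * √n * (n / Real.exp 1) ^ n := by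
    have h := Stirling.stirlingSeq'_antitone (Nat.zero_le m)
    simp only [Function.comp_apply, Nat.succ_eq_add_one, zero_add, Stirling.stirlingSeq_one,
      ← hn] at h
    rw [Stirling.stirlingSeq, div_le_iff₀ (by positivity)] at h
    refine h.trans_eq ?_
    rw [Real.sqrt_mul zero_le_two]
    field_simp
  -- `s ^ k ≥ exp (-n - lam)`, because `k < n / lam + 1`.
  have hsk : Real.exp (-n - lam) ≤ s ^ k := by
    rw [hs, ← Real.exp_nat_mul]
    apply Real.exp_le_exp.2
    have : (k : ℝ) * lam ≤ (n / lam + 1) * lam := by gcongr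
    have h4 : (n / lam + 1) * lam = n + lam := by field_simp
    linarith
  have hmain : Real.exp (-lam - 1) / √n / lam ^ n ≤ s ^ k * k ^ n / n.factorial := by
    calc Real.exp (-lam - 1) / √n / lam ^ n
      _ = Real.exp (-n - lam) * (n / lam) ^ n / (Real.exp 1 * √n * (n / Real.exp 1) ^ n) := by
        have : Real.exp (-n - lam) = Real.exp (-lam - 1) * Real.exp 1 / Real.exp 1 ^ n := by
          rw [← Real.exp_nat_mul, ← Real.exp_add, ← Real.exp_sub]
          ring_nf
        rw [this, div_pow, div_pow]
        field_simp
      _ ≤ _ := by gcongr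
  have hle := le_hasSum (hasSum_bivariate m h0 h1).summable.hasSum (k, k)
    (fun p _ => by positivity)
  dsimp only at hle
  have hmc := pow_div_le_multichoose (k * k) n
  have h1s : 0 < 1 - s := by linarith
  calc _ = (Real.exp (-lam - 1) / √n / lam ^ n) * (Real.exp (-lam - 1) / √n / lam ^ n) *
        ((1 - s) ^ (2 * (m + 2)) / s ^ 2) := by
        clear_value n
        rw [show 2 * (m + 2) = n + n + 2 by omega, two_mul n, div_pow, pow_add, pow_add, pow_add,
          show -2 * lam - 2 = (-lam - 1) + (-lam - 1) by ring, Real.exp_add]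
        field_simp
        rw [Real.sq_sqrt hn0.le]
        ring
    _ ≤ (s ^ k * k ^ n / n.factorial) * (s ^ k * k ^ n / n.factorial) *
        ((1 - s) ^ (2 * (m + 2)) / s ^ 2) := by gcongr
    _ = s ^ k * s ^ k * (((k * k : ℕ) : ℝ) ^ n / n.factorial) / n.factorial *
        ((1 - s) ^ (2 * (m + 2)) / s ^ 2) := by
        push_cast
        rw [mul_pow]
        ring
    _ ≤ s ^ k * s ^ k * ((k * k).multichoose n : ℝ) / n.factorial *
        ((1 - s) ^ (2 * (m + 2)) / s ^ 2) := by gcongr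
    _ ≤ _ := by gcongr

/-! ### The functions `L` and `J` -/

theorem L_eq_log_dslope (t : ℝ) : L t = Real.log (dslope Real.exp 0 t) := by
  unfold L
  split_ifs with h
  · simp [h]
  · rw [dslope_of_ne _ h, slope_def_field, Real.exp_zero, sub_zero]

theorem dslope_exp_pos (t : ℝ) : 0 < dslope Real.exp 0 t := by
  rcases eq_or_ne t 0 with rfl | h
  · simp
  · rw [dslope_of_ne _ h, slope_def_field, Real.exp_zero, sub_zero]
    rcases h.lt_or_gt with h | h
    · exact div_pos_of_neg_of_neg (by linarith [Real.exp_lt_one_iff.2 h]) h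
    · exact div_pos (by linarith [Real.one_lt_exp_iff.2 h]) h

theorem differentiable_L : Differentiable ℝ L := by
  have h : L = fun t => Real.log (dslope Real.exp 0 t) := funext L_eq_log_dslope
  rw [h]
  refine Differentiable.log (fun t => ?_) fun t => (dslope_exp_pos t).ne'
  rcases eq_or_ne t 0 with rfl | ht
  · obtain ⟨p, hp⟩ := (analyticAt_rexp : AnalyticAt ℝ Real.exp 0)
    exact hp.has_fpower_series_dslope_fslope.differentiableAt
  · exact (differentiableAt_dslope_of_ne ht).2 Real.differentiable_exp.differentiableAt

theorem L_zero : L 0 = 0 := by simp [L]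

theorem L_neg (t : ℝ) : L (-t) = L t - t := by
  rcases eq_or_ne t 0 with rfl | h
  · simp
  · have hd := dslope_exp_pos t
    rw [dslope_of_ne _ h, slope_def_field, Real.exp_zero, sub_zero] at hd
    simp only [L, h, neg_eq_zero, if_false]
    rw [← Real.log_exp t, ← Real.log_div (by simpa using hd.ne') (Real.exp_pos _).ne']
    simp only [Real.log_exp]
    congr 1
    rw [Real.exp_neg]
    have := Real.exp_pos t
    field_simp
    ring

theorem L_eq_of_pos {t : ℝ} (ht : 0 < t) :
    L t = t - Real.log t + Real.log (1 - Real.exp (-t)) := by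
  have h1 : Real.exp (-t) < 1 := Real.exp_lt_one_iff.2 (by linarith)
  rw [L, if_neg ht.ne', show Real.exp t - 1 = Real.exp t * (1 - Real.exp (-t)) by
    rw [mul_sub, ← Real.exp_add]; simp, Real.log_div (mul_ne_zero (Real.exp_pos _).ne'
      (by linarith)) ht.ne', Real.log_mul (Real.exp_pos _).ne' (by linarith), Real.log_exp]
  ring

theorem L_le_sub_log {t : ℝ} (ht : 0 < t) : L t ≤ t - Real.log t := by
  rw [L_eq_of_pos ht]
  have h1 : Real.exp (-t) < 1 := Real.exp_lt_one_iff.2 (by linarith)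
  have : Real.log (1 - Real.exp (-t)) ≤ 0 :=
    Real.log_nonpos (by linarith) (by linarith [Real.exp_pos (-t)])
  linarith

theorem tendsto_L_sub_atTop {c : ℝ} (hc : c < 1) :
    Tendsto (fun t => L t - c * t) atTop atTop := by
  have h1 : Tendsto (fun t : ℝ => (1 - c) - Real.log t / t) atTop (𝓝 (1 - c - 0)) :=
    tendsto_const_nhds.sub Real.isLittleO_log_id_atTop.tendsto_div_nhds_zero
  have h2 := (tendsto_id (α := ℝ) (x := atTop)).atTop_mul_pos
    (by linarith : 0 < 1 - c - 0) h1
  have h3 := tendsto_atTop_add_const_right _ (Real.log (1 - Real.exp (-1))) h2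
  refine tendsto_atTop_mono' _ ?_ h3
  filter_upwards [eventually_ge_atTop 1] with t ht
  have ht0 : 0 < t := by linarith
  have hlt : Real.exp (-1) < 1 := Real.exp_lt_one_iff.2 (by norm_num)
  have : Real.log (1 - Real.exp (-1)) ≤ Real.log (1 - Real.exp (-t)) :=
    Real.log_le_log (by linarith) (by linarith [Real.exp_le_exp.2 (neg_le_neg ht)])
  rw [L_eq_of_pos ht0]
  simp only [id]
  have : t * (1 - c - Real.log t / t) = t - c * t - Real.log t := by field_simp
  linarith

theorem tendsto_log_moment_neg {lam : ℝ} (hl : 0 < lam) :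
    Tendsto (fun n : ℕ => Real.log (moment n (-lam)) / n) atTop (𝓝 (2 * L (-lam))) := by
  have h1 : Real.exp (-lam) < 1 := Real.exp_lt_one_iff.2 (by linarith)
  have h1s : 0 < 1 - Real.exp (-lam) := by linarith
  have h0 := Real.exp_pos (-lam)
  have hL : L (-lam) = Real.log ((1 - Real.exp (-lam)) / lam) := by
    rw [L, if_neg (by linarith), ← neg_div_neg_eq]
    simp
  have hconst : ∀ c : ℝ, Tendsto (fun n : ℕ => c / (n : ℝ)) atTop (𝓝 0) := fun c =>
    tendsto_const_div_atTop_nhds_zero_nat c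
  have hlog : Tendsto (fun n : ℕ => Real.log n / (n : ℝ)) atTop (𝓝 0) :=
    Real.isLittleO_log_id_atTop.tendsto_div_nhds_zero.comp tendsto_natCast_atTop_atTop
  have hsqrt : Tendsto (fun n : ℕ => √(n : ℝ) / n) atTop (𝓝 0) := by
    simp only [Real.sqrt_div_self]
    exact tendsto_inv_atTop_zero.comp
      (Real.tendsto_sqrt_atTop.comp tendsto_natCast_atTop_atTop) |>.congr (by simp)
  rw [hL]
  refine tendsto_order.2 ⟨fun b hb => ?_, fun b hb => ?_⟩
  · set c := Real.exp (-2 * lam - 2) * ((1 - Real.exp (-lam)) ^ 2 / Real.exp (-lam) ^ 2) with hc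
    have hc0 : 0 < c := by positivity
    have ht : Tendsto (fun n : ℕ => Real.log c / n - Real.log n / n +
        2 * Real.log ((1 - Real.exp (-lam)) / lam)) atTop
        (𝓝 (0 - 0 + 2 * Real.log ((1 - Real.exp (-lam)) / lam))) :=
      ((hconst _).sub hlog).add_const _
    filter_upwards [ht.eventually (lt_mem_nhds (by simpa using hb)), eventually_ge_atTop 1]
      with n hn hn1
    refine hn.trans_le ?_
    obtain ⟨m, rfl⟩ : ∃ m, n = m + 1 := ⟨n - 1, by omega⟩
    have hn0 : (0 : ℝ) < (m + 1 : ℕ) := by exact_mod_cast Nat.succ_pos m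
    have h := Real.log_le_log (by positivity) (le_moment_neg hl m)
    rw [Real.log_mul (by positivity) (by positivity), Real.log_div hc0.ne' hn0.ne',
      Real.log_pow] at h
    rw [le_div_iff₀ hn0]
    refine le_trans (le_of_eq ?_) h
    rw [add_mul, sub_mul, div_mul_cancel₀ _ hn0.ne', div_mul_cancel₀ _ hn0.ne']
    push_cast
    ring
  · have hcont : Tendsto (fun mu => 2 * Real.log ((1 - Real.exp (-lam)) / mu)) (𝓝[<] lam)
        (𝓝 (2 * Real.log ((1 - Real.exp (-lam)) / lam))) := by
      have : ContinuousAt (fun mu => 2 * Real.log ((1 - Real.exp (-lam)) / mu)) lam :=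
        ((continuousAt_const.div continuousAt_id hl.ne').log (div_pos h1s hl).ne').const_mul 2
      exact this.tendsto.mono_left nhdsWithin_le_nhds
    obtain ⟨mu, hmub, hmu⟩ := ((hcont.eventually (gt_mem_nhds hb)).and
      (Ioo_mem_nhdsLT hl)).exists
    obtain ⟨hmu0, hmul⟩ := hmu
    have hr1 : Real.exp (-(lam - mu)) < 1 := Real.exp_lt_one_iff.2 (by linarith)
    have hr1' : 0 < 1 - Real.exp (-(lam - mu)) := by linarith
    set C := (1 - Real.exp (-(lam - mu)))⁻¹ ^ 2 *
      ((1 - Real.exp (-lam)) ^ 2 / Real.exp (-lam) ^ 2) with hC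
    have hC0 : 0 < C := by positivity
    have ht : Tendsto (fun n : ℕ => Real.log C / n + 2 * mu * (√(n : ℝ) / n) +
        2 * Real.log ((1 - Real.exp (-lam)) / mu)) atTop
        (𝓝 (0 + 2 * mu * 0 + 2 * Real.log ((1 - Real.exp (-lam)) / mu))) :=
      ((hconst _).add (hsqrt.const_mul _)).add_const _
    filter_upwards [ht.eventually (gt_mem_nhds (by simpa using hmub)), eventually_ge_atTop 1]
      with n hn hn1
    refine lt_of_le_of_lt ?_ hn
    obtain ⟨m, rfl⟩ : ∃ m, n = m + 1 := ⟨n - 1, by omega⟩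
    have hn0 : (0 : ℝ) < (m + 1 : ℕ) := by exact_mod_cast Nat.succ_pos m
    have h := Real.log_le_log (moment_pos _ _) (moment_neg_le hmu0 hmul m)
    rw [Real.log_mul (by positivity) (by positivity), Real.log_mul hC0.ne' (by positivity),
      Real.log_exp, Real.log_pow] at h
    rw [div_le_iff₀ hn0]
    refine h.trans (le_of_eq ?_)
    rw [add_mul, add_mul, mul_assoc _ (_ / _), div_mul_cancel₀ _ hn0.ne',
      div_mul_cancel₀ _ hn0.ne']
    push_cast
    ring

theorem tendsto_log_moment (t : ℝ) :
    Tendsto (fun n : ℕ => Real.log (moment n t) / n) atTop (𝓝 (2 * L t)) := by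
  rcases lt_trichotomy t 0 with ht | rfl | ht
  · simpa using tendsto_log_moment_neg (neg_pos.2 ht)
  · simp [moment_zero, L_zero]
  · have h := (tendsto_log_moment_neg ht).const_add (2 * t)
    have h2 := h.sub (tendsto_const_div_atTop_nhds_zero_nat (2 * t))
    rw [L_neg, show 2 * t + 2 * (L t - t) - 0 = 2 * L t by ring] at h2
    refine h2.congr' ?_
    filter_upwards [eventually_ge_atTop 1] with n hn1
    obtain ⟨m, rfl⟩ : ∃ m, n = m + 1 := ⟨n - 1, by omega⟩
    rw [moment_neg m t, Real.log_mul (Real.exp_pos _).ne' (moment_pos _ _).ne', Real.log_exp]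
    have hn0 : ((m + 1 : ℕ) : ℝ) ≠ 0 := by exact_mod_cast (Nat.succ_ne_zero m)
    field_simp
    push_cast
    ring

/-- `J` is the Legendre transform of `2 * L`. The infimum defining `J y` is attained at `x = y / 2`. -/
theorem J_eq_iSup (y : ℝ) : J y = ⨆ t : ℝ, ((y * t - 2 * L t : ℝ) : EReal) := by
  apply le_antisymm
  · refine (iInf_le _ (y / 2)).trans ?_
    rw [show y - y / 2 = y / 2 by ring]
    refine EReal.add_le_of_forall_lt fun a ha b hb => ?_
    obtain ⟨t₁, h₁⟩ := lt_iSup_iff.1 ha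
    obtain ⟨t₂, h₂⟩ := lt_iSup_iff.1 hb
    refine (add_le_add h₁.le h₂.le).trans ?_
    rw [← EReal.coe_add]
    rcases le_total (y / 2 * t₁ - L t₁) (y / 2 * t₂ - L t₂) with h | h
    · refine le_trans (EReal.coe_le_coe_iff.2 ?_)
        (le_iSup (fun t : ℝ => ((y * t - 2 * L t : ℝ) : EReal)) t₂)
      linarith
    · refine le_trans (EReal.coe_le_coe_iff.2 ?_)
        (le_iSup (fun t : ℝ => ((y * t - 2 * L t : ℝ) : EReal)) t₁)
      linarith
  · refine le_iInf fun x => iSup_le fun t => ?_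
    rw [show y * t - 2 * L t = (x * t - L t) + ((y - x) * t - L t) by ring, EReal.coe_add]
    exact add_le_add (le_iSup (fun t : ℝ => ((x * t - L t : ℝ) : EReal)) t)
      (le_iSup (fun t : ℝ => (((y - x) * t - L t : ℝ) : EReal)) t)

theorem le_J (y t : ℝ) : ((y * t - 2 * L t : ℝ) : EReal) ≤ J y := by
  rw [J_eq_iSup]
  exact le_iSup (fun t : ℝ => ((y * t - 2 * L t : ℝ) : EReal)) t

theorem J_eq_top_of_two_le {y : ℝ} (hy : 2 ≤ y) : J y = ⊤ := by
  rw [EReal.eq_top_iff_forall_lt]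
  intro r
  obtain ⟨t, ht, ht1⟩ := ((Real.tendsto_log_atTop.eventually_gt_atTop (r / 2)).and
    (eventually_gt_atTop 0)).exists
  refine lt_of_lt_of_le (EReal.coe_lt_coe_iff.2 ?_) (le_J y t)
  nlinarith [L_le_sub_log ht1]

theorem J_eq_top_of_nonpos {y : ℝ} (hy : y ≤ 0) : J y = ⊤ := by
  rw [EReal.eq_top_iff_forall_lt]
  intro r
  obtain ⟨t, ht, ht1⟩ := ((Real.tendsto_log_atTop.eventually_gt_atTop (r / 2)).and
    (eventually_gt_atTop 0)).exists
  refine lt_of_lt_of_le (EReal.coe_lt_coe_iff.2 ?_) (le_J y (-t))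
  rw [L_neg]
  nlinarith [L_le_sub_log ht1]

theorem mem_Ioo_of_J_ne_top {y : ℝ} (h : J y ≠ ⊤) : y ∈ Set.Ioo 0 2 :=
  ⟨not_le.1 fun hy => h (J_eq_top_of_nonpos hy), not_le.1 fun hy => h (J_eq_top_of_two_le hy)⟩

/-- The slope `y` is attained where `2 * L t - y * t`, which tends to `∞` at `±∞`, is minimal. -/
theorem exists_hasDerivAt_of_mem_Ioo {y : ℝ} (hy : y ∈ Set.Ioo 0 2) :
    ∃ t, HasDerivAt (fun t => 2 * L t) y t := by
  have hcont : Continuous fun t => 2 * L t - y * t :=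
    (differentiable_L.continuous.const_mul 2).sub (continuous_const.mul continuous_id)
  have hlim : Tendsto (fun t => 2 * L t - y * t) (cocompact ℝ) atTop := by
    rw [cocompact_eq_atBot_atTop, tendsto_sup]
    constructor
    · have h := ((tendsto_L_sub_atTop (c := (2 - y) / 2) (by linarith [hy.1])).const_mul_atTop
        (zero_lt_two)).comp tendsto_neg_atBot_atTop
      refine h.congr fun t => ?_
      simp only [Function.comp_apply, L_neg]
      ring
    · refine ((tendsto_L_sub_atTop (c := y / 2) (by linarith [hy.2])).const_mul_atTop
        (zero_lt_two)).congr fun t => ?_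
      ring
  obtain ⟨t, ht⟩ := hcont.exists_forall_le hlim
  have hd : HasDerivAt (fun t => 2 * L t - y * t) (2 * deriv L t - y * 1) t :=
    ((differentiable_L t).hasDerivAt.const_mul 2).sub ((hasDerivAt_id t).const_mul y)
  have hmin : IsLocalMin (fun t => 2 * L t - y * t) t := Eventually.of_forall ht
  have h0 := hmin.hasDerivAt_eq_zero hd
  refine ⟨t, ?_⟩
  rw [show y = 2 * deriv L t by linarith]
  exact (differentiable_L t).hasDerivAt.const_mul 2

theorem isGoodRateFunction_J : IsGoodRateFunction J := by
  have hlsc : LowerSemicontinuous J := by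
    rw [show J = fun y => ⨆ t : ℝ, ((y * t - 2 * L t : ℝ) : EReal) from funext J_eq_iSup]
    refine lowerSemicontinuous_iSup fun t => Continuous.lowerSemicontinuous ?_
    exact continuous_coe_real_ereal.comp (by fun_prop)
  refine ⟨fun y => ?_, hlsc, fun a => ?_⟩
  · simpa [L_zero] using le_J y 0
  · refine isCompact_Icc.of_isClosed_subset (hlsc.isClosed_preimage (a : EReal))
      (fun y (hy : J y ≤ a) => Set.Ioo_subset_Icc_self
        (mem_Ioo_of_J_ne_top (hy.trans_lt (EReal.coe_lt_top a)).ne))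

/-! ### Large deviations from exponential moments -/

open ExpGrowth

theorem ofReal_exp_mul_natCast (c : ℝ) (n : ℕ) :
    ENNReal.ofReal (Real.exp (c * n)) = EReal.exp ((c : EReal) * n) := by
  rw [← EReal.exp_coe, EReal.coe_mul, EReal.coe_natCast]

theorem expGrowthSup_ofReal_exp (c : ℝ) :
    expGrowthSup (fun n : ℕ => ENNReal.ofReal (Real.exp (c * n))) = c := by
  simp only [ofReal_exp_mul_natCast, expGrowthSup_exp]

theorem expGrowthInf_ofReal_exp (c : ℝ) :
    expGrowthInf (fun n : ℕ => ENNReal.ofReal (Real.exp (c * n))) = c := by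
  simp only [ofReal_exp_mul_natCast, expGrowthInf_exp]

theorem expGrowthInf_add_le (u v : ℕ → ℝ≥0∞) :
    expGrowthInf (u + v) ≤ max (expGrowthInf u) (expGrowthSup v) := by
  have h : expGrowthInf (u + v) ≤ expGrowthInf (u ⊔ v) := by
    refine expGrowthInf_le_of_eventually_le (b := 2) (by simp) (Eventually.of_forall fun n => ?_)
    rw [two_mul]
    exact add_le_add le_sup_left le_sup_right
  refine h.trans (le_of_forall_gt_imp_ge_of_dense fun a ha => ?_)
  have hu := frequently_le_exp ((le_max_left _ _).trans_lt ha)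
  have hv := eventually_le_exp ((le_max_right _ _).trans_lt ha)
  exact Frequently.expGrowthInf_le ((hu.and_eventually hv).mono fun n hn => sup_le hn.1 hn.2)

section MeasureBounds

variable {Ω : Type*} [MeasurableSpace Ω]

/-- The exponential moment `E[exp (t n Z n)]`, with values in `ℝ≥0∞`. -/
noncomputable def expMoment (P : Measure Ω) (Z : ℕ → Ω → ℝ) (t : ℝ) (n : ℕ) : ℝ≥0∞ :=
  ∫⁻ ω, ENNReal.ofReal (Real.exp (t * Z n ω * n)) ∂P

/-- Markov's inequality for `exp (t n Z n)`. -/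
theorem measure_half_le (P : Measure Ω) {Z : ℕ → Ω → ℝ} (hZ : ∀ n, Measurable (Z n))
    (t c : ℝ) (n : ℕ) :
    P {ω | c ≤ t * Z n ω} ≤ expMoment P Z t n * ENNReal.ofReal (Real.exp (-c * n)) := by
  have hpos := Real.exp_pos (c * n)
  have h := meas_ge_le_lintegral_div (μ := P)
    (f := fun ω => ENNReal.ofReal (Real.exp (t * Z n ω * n)))
    (ε := ENNReal.ofReal (Real.exp (c * n))) (by fun_prop)
    (by simpa using hpos) (by simp)
  rw [div_eq_mul_inv, ← ENNReal.ofReal_inv_of_pos hpos, ← Real.exp_neg, ← neg_mul] at h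
  refine (measure_mono fun ω (hω : c ≤ t * Z n ω) => ?_).trans h
  change ENNReal.ofReal _ ≤ ENNReal.ofReal _
  gcongr

theorem expGrowthSup_measure_half_le (P : Measure Ω) {Z : ℕ → Ω → ℝ}
    (hZ : ∀ n, Measurable (Z n)) {t l : ℝ}
    (hl : expGrowthSup (expMoment P Z t) = l) (c : ℝ) :
    expGrowthSup (fun n => P {ω | c ≤ t * Z n ω}) ≤ ((l - c : ℝ) : EReal) := by
  refine (expGrowthSup_monotone (fun n => measure_half_le P hZ t c n)).trans ?_
  refine (expGrowthSup_mul_le (u := expMoment P Z t)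
    (v := fun n => ENNReal.ofReal (Real.exp (-c * n))) ?_ ?_).trans ?_
  · simp [hl]
  · simp [hl]
  · rw [hl, expGrowthSup_ofReal_exp, ← EReal.coe_add, sub_eq_add_neg]

/-- The upper bound of the Gärtner–Ellis theorem, for random variables with values in a compact
set. -/
theorem expGrowthSup_measure_le (P : Measure Ω) {Z : ℕ → Ω → ℝ} (hZ : ∀ n, Measurable (Z n))
    {Λ : ℝ → ℝ} (hΛ : ∀ t, expGrowthSup (expMoment P Z t) = Λ t) {K : Set ℝ} (hK : IsCompact K)
    (hZK : ∀ n ω, Z n ω ∈ K) (B : Set ℝ) :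
    expGrowthSup (fun n => P (Z n ⁻¹' B)) ≤
      -(⨅ y ∈ closure B, ⨆ t : ℝ, ((y * t - Λ t : ℝ) : EReal)) := by
  apply EReal.le_neg_of_le_neg
  refine EReal.ge_of_forall_gt_iff_ge.1 fun a ha => ?_
  apply EReal.le_neg_of_le_neg
  -- Cover the compact set by half-lines on which a single `t` gives a rate above `a`.
  have hcov : K ∩ closure B ⊆ ⋃ t : ℝ, {y : ℝ | a < y * t - Λ t} := by
    rintro y ⟨-, hy⟩
    obtain ⟨t, ht⟩ := lt_iSup_iff.1 (ha.trans_le (iInf₂_le y hy))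
    exact Set.mem_iUnion.2 ⟨t, EReal.coe_lt_coe_iff.1 ht⟩
  obtain ⟨s, hs⟩ := (hK.inter_right isClosed_closure).elim_finite_subcover _
    (fun t => isOpen_lt continuous_const (by fun_prop)) hcov
  have hle : (fun n => P (Z n ⁻¹' B)) ≤ ∑ t ∈ s, fun n => P {ω | a + Λ t ≤ t * Z n ω} := by
    intro n
    rw [Finset.sum_apply]
    refine (measure_mono fun ω hω => ?_).trans (measure_biUnion_finset_le s _)
    have := hs ⟨hZK n ω, subset_closure hω⟩
    simp only [Set.mem_iUnion] at this ⊢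
    obtain ⟨t, hts, ht⟩ := this
    refine ⟨t, hts, ?_⟩
    change a + Λ t ≤ t * Z n ω
    have ht' : a < Z n ω * t - Λ t := ht
    linarith
  refine (expGrowthSup_monotone hle).trans ?_
  rw [expGrowthSup_sum]
  refine iSup₂_le fun t _ => ?_
  refine (expGrowthSup_measure_half_le P hZ (hΛ t) _).trans_eq ?_
  rw [← EReal.coe_neg]
  congr 1
  ring

/-- The lower bound of the Gärtner–Ellis theorem at a point `y` which is a slope of `Λ`. In the
exponential moment at `t`, the contributions of `Z ≥ y + δ` and `Z ≤ y - δ` are exponentially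
smaller than the total, because they are controlled by the exponential moments at `t ± h` for small
`h`. Hence the event `|Z - y| < δ` carries the full exponential growth. -/
theorem le_expGrowthInf_measure (P : Measure Ω) {Z : ℕ → Ω → ℝ} (hZ : ∀ n, Measurable (Z n))
    {Λ : ℝ → ℝ} (hΛ : ∀ t, expGrowthSup (expMoment P Z t) = Λ t)
    (hΛ' : ∀ t, expGrowthInf (expMoment P Z t) = Λ t) {y t : ℝ} (hd : HasDerivAt Λ y t)
    {B : Set ℝ} (hB : MeasurableSet B) (hy : y ∈ interior B) :
    ((Λ t - y * t : ℝ) : EReal) ≤ expGrowthInf (fun n => P (Z n ⁻¹' B)) := by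
  refine EReal.ge_of_forall_gt_iff_ge.1 fun z hz => ?_
  have hz' : 0 < Λ t - y * t - z := by linarith [EReal.coe_lt_coe_iff.1 hz]
  obtain ⟨δ₀, hδ₀, hball⟩ := Metric.mem_nhds_iff.1 (mem_interior_iff_mem_nhds.1 hy)
  obtain ⟨δ, hδ, hδle, hδz⟩ : ∃ δ, 0 < δ ∧ δ ≤ δ₀ ∧ |t| * δ ≤ Λ t - y * t - z := by
    refine ⟨min δ₀ ((Λ t - y * t - z) / (|t| + 1)), by positivity, min_le_left _ _, ?_⟩
    calc |t| * min δ₀ ((Λ t - y * t - z) / (|t| + 1))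
        ≤ (|t| + 1) * ((Λ t - y * t - z) / (|t| + 1)) := by
          gcongr
          · linarith
          · exact min_le_right _ _
      _ = _ := by field_simp
  -- The difference quotients of `Λ` at `t` lie within `δ` of `y` for small increments `±h`.
  obtain ⟨h, hh, hp, hm⟩ : ∃ h, 0 < h ∧ Λ (t + h) - h * (y + δ) < Λ t ∧
      Λ (t - h) + h * (y - δ) < Λ t := by
    have hs := hasDerivAt_iff_tendsto_slope_zero.1 hd
    have hev := hs.eventually (Metric.ball_mem_nhds y hδ)
    rw [eventually_nhdsWithin_iff, Metric.eventually_nhds_iff] at hev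
    obtain ⟨r, hr, hr'⟩ := hev
    have hr2 : 0 < r / 2 := by linarith
    have h1 := hr' (y := r / 2) (by simp [abs_of_pos hr, hr]) (by simpa using hr.ne')
    have h2 := hr' (y := -(r / 2)) (by simp [abs_of_pos hr, hr]) (by simpa using hr.ne')
    rw [Real.dist_eq, smul_eq_mul, abs_lt] at h1 h2
    refine ⟨r / 2, hr2, ?_, ?_⟩
    · have := mul_lt_mul_of_pos_left h1.2 hr2
      rw [mul_sub, mul_inv_cancel_left₀ hr2.ne'] at this
      linarith
    · have := mul_lt_mul_of_pos_left h2.1 hr2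
      rw [mul_sub, inv_neg, neg_mul, mul_neg, mul_neg, mul_inv_cancel_left₀ hr2.ne',
        ← sub_eq_add_neg] at this
      linarith
  set c := y * t + |t| * δ with hc
  have hsplit : expMoment P Z t ≤
      (fun n => P (Z n ⁻¹' B) * ENNReal.ofReal (Real.exp (c * n))) +
      ((expMoment P Z (t + h) * fun n : ℕ => ENNReal.ofReal (Real.exp (-(h * (y + δ)) * n))) +
        (expMoment P Z (t - h) * fun n : ℕ => ENNReal.ofReal (Real.exp (h * (y - δ) * n)))) := by
    intro n
    simp only [Pi.add_apply, Pi.mul_apply, expMoment]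
    rw [← lintegral_mul_const _ (by fun_prop), ← lintegral_mul_const _ (by fun_prop),
      ← lintegral_add_left (by fun_prop), mul_comm (P _),
      ← lintegral_indicator_const (hZ n hB), ← lintegral_add_right _ (by fun_prop)]
    refine lintegral_mono fun ω => ?_
    dsimp only
    rw [← ENNReal.ofReal_mul (Real.exp_pos _).le, ← ENNReal.ofReal_mul (Real.exp_pos _).le,
      ← Real.exp_add, ← Real.exp_add]
    have hn : (0 : ℝ) ≤ n := n.cast_nonneg
    rcases le_or_gt (y + δ) (Z n ω) with h1 | h1
    · refine le_add_left (le_add_right (ENNReal.ofReal_le_ofReal (Real.exp_le_exp.2 ?_)))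
      have := mul_le_mul_of_nonneg_right (mul_le_mul_of_nonneg_left h1 hh.le) hn
      linarith
    rcases le_or_gt (Z n ω) (y - δ) with h2 | h2
    · refine le_add_left (le_add_left (ENNReal.ofReal_le_ofReal (Real.exp_le_exp.2 ?_)))
      have := mul_le_mul_of_nonneg_right (mul_le_mul_of_nonneg_left h2 hh.le) hn
      linarith
    · have hab : |Z n ω - y| < δ := abs_lt.2 ⟨by linarith, by linarith⟩
      have hmem : ω ∈ Z n ⁻¹' B := hball (Metric.ball_subset_ball hδle hab)
      rw [Set.indicator_of_mem hmem]
      refine le_add_right (ENNReal.ofReal_le_ofReal (Real.exp_le_exp.2 ?_))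
      gcongr
      have h3 : t * (Z n ω - y) ≤ |t| * δ :=
        (le_abs_self _).trans ((abs_mul _ _).trans_le (by gcongr))
      linarith
  have hv : expGrowthSup
      ((expMoment P Z (t + h) * fun n : ℕ => ENNReal.ofReal (Real.exp (-(h * (y + δ)) * n))) +
        (expMoment P Z (t - h) * fun n : ℕ => ENNReal.ofReal (Real.exp (h * (y - δ) * n)))) <
      Λ t := by
    rw [expGrowthSup_add]
    refine sup_lt_iff.2 ⟨?_, ?_⟩
    · refine (expGrowthSup_mul_le (by simp [hΛ]) (by simp [hΛ])).trans_lt ?_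
      rw [hΛ, expGrowthSup_ofReal_exp, ← EReal.coe_add, EReal.coe_lt_coe_iff]
      linarith
    · refine (expGrowthSup_mul_le (by simp [hΛ]) (by simp [hΛ])).trans_lt ?_
      rw [hΛ, expGrowthSup_ofReal_exp, ← EReal.coe_add, EReal.coe_lt_coe_iff]
      linarith
  have hu : (Λ t : EReal) ≤
      expGrowthInf (fun n => P (Z n ⁻¹' B) * ENNReal.ofReal (Real.exp (c * n))) := by
    have h1 := (expGrowthInf_monotone hsplit).trans (expGrowthInf_add_le _ _)
    rw [hΛ'] at h1
    exact (le_max_iff.1 h1).resolve_right (not_le.2 hv)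
  have hfin := le_expGrowthInf_mul
    (u := fun n => P (Z n ⁻¹' B) * ENNReal.ofReal (Real.exp (c * n)))
    (v := fun n : ℕ => ENNReal.ofReal (Real.exp (-c * n)))
  have hcancel : (fun n => P (Z n ⁻¹' B) * ENNReal.ofReal (Real.exp (c * n))) *
      (fun n : ℕ => ENNReal.ofReal (Real.exp (-c * n))) = fun n => P (Z n ⁻¹' B) := by
    funext n
    simp only [Pi.mul_apply]
    rw [mul_assoc, ← ENNReal.ofReal_mul (Real.exp_pos _).le, ← Real.exp_add]
    simp
  rw [hcancel, expGrowthInf_ofReal_exp] at hfin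
  refine le_trans ?_ ((add_le_add_left hu _).trans hfin)
  rw [← EReal.coe_add, EReal.coe_le_coe_iff]
  linarith

end MeasureBounds

/-! ### The uniform random permutation -/

section
variable {Ω : Type*} [MeasurableSpace Ω] {P : Measure Ω} {n : ℕ} {π : Ω → Equiv.Perm (Fin n)}

theorem IsUniformPermutation.measurable_comp (h : IsUniformPermutation P π)
    (f : Equiv.Perm (Fin n) → ℝ) : Measurable fun ω => f (π ω) := by
  intro B _
  have : (fun ω => f (π ω)) ⁻¹' B = ⋃ σ ∈ {σ | f σ ∈ B}, π ⁻¹' {σ} := by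
    ext ω
    simp
  rw [this]
  exact MeasurableSet.biUnion (Set.to_countable _) fun σ _ => (h σ).1

theorem IsUniformPermutation.lintegral_comp (h : IsUniformPermutation P π)
    (f : Equiv.Perm (Fin n) → ℝ≥0∞) :
    ∫⁻ ω, f (π ω) ∂P = ∑ σ, f σ * ((n.factorial : ℕ) : ℝ≥0∞)⁻¹ := by
  classical
  have he : ∀ ω, f (π ω) = ∑ σ, (π ⁻¹' {σ}).indicator (fun _ => f σ) ω := fun ω => by
    simp [Set.indicator_apply]
  simp only [he]
  rw [lintegral_finsetSum _ fun σ _ => measurable_const.indicator (h σ).1]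
  refine Finset.sum_congr rfl fun σ _ => ?_
  rw [lintegral_indicator_const (h σ).1, (h σ).2]

theorem IsUniformPermutation.lintegral_exp (h : IsUniformPermutation P π) (t : ℝ) :
    ∫⁻ ω, ENNReal.ofReal (Real.exp (t * twoSidedDescents (π ω))) ∂P =
      ENNReal.ofReal (moment n t) := by
  have hf : (0 : ℝ) < n.factorial := by exact_mod_cast n.factorial_pos
  rw [h.lintegral_comp fun σ => ENNReal.ofReal (Real.exp (t * twoSidedDescents σ)), moment,
    ← Finset.sum_mul, ← ENNReal.ofReal_sum_of_nonneg fun _ _ => (Real.exp_pos _).le,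
    ENNReal.ofReal_div_of_pos hf, ENNReal.ofReal_natCast, div_eq_mul_inv]

theorem twoSidedDescents_div_mem_Icc (σ : Equiv.Perm (Fin n)) :
    (twoSidedDescents σ : ℝ) / n ∈ Set.Icc (0 : ℝ) 2 := by
  refine ⟨by positivity, div_le_of_le_mul₀ (by positivity) (by norm_num) ?_⟩
  have h1 := descents_le σ
  have h2 := descents_le σ⁻¹
  have : twoSidedDescents σ ≤ 2 * n := by
    unfold twoSidedDescents
    omega
  exact_mod_cast this

end

theorem tendsto_log_expMoment {Ω : Type*} [MeasurableSpace Ω] {P : Measure Ω}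
    {π : (n : ℕ) → Ω → Equiv.Perm (Fin n)} (hπ : ∀ n, IsUniformPermutation P (π n)) (t : ℝ) :
    Tendsto (fun n : ℕ => ENNReal.log
      (expMoment P (fun n ω => (twoSidedDescents (π n ω) : ℝ) / n) t n) / (n : EReal)) atTop
      (𝓝 ((2 * L t : ℝ) : EReal)) := by
  refine (continuous_coe_real_ereal.continuousAt.tendsto.comp (tendsto_log_moment t)).congr' ?_
  filter_upwards [eventually_ge_atTop 1] with n hn
  have hn0 : (n : ℝ) ≠ 0 := by
    have : n ≠ 0 := by omega
    exact_mod_cast this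
  have he : expMoment P (fun n ω => (twoSidedDescents (π n ω) : ℝ) / n) t n =
      ENNReal.ofReal (moment n t) := by
    rw [← (hπ n).lintegral_exp t, expMoment]
    refine lintegral_congr fun ω => ?_
    rw [mul_assoc, div_mul_cancel₀ _ hn0]
  rw [he, ENNReal.log_ofReal_of_pos (moment_pos n t)]
  simp only [Function.comp_apply]
  rw [EReal.coe_div, EReal.coe_natCast]

theorem satisfiesLDP_twoSidedDescents {Ω : Type*} [MeasurableSpace Ω] (P : Measure Ω)
    {π : (n : ℕ) → Ω → Equiv.Perm (Fin n)} (hπ : ∀ n, IsUniformPermutation P (π n)) :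
    SatisfiesLDP P (fun (n : ℕ) ω => (twoSidedDescents (π n ω) : ℝ) / (n : ℝ)) J := by
  set Z : ℕ → Ω → ℝ := fun n ω => (twoSidedDescents (π n ω) : ℝ) / n with hZdef
  have hZ : ∀ n, Measurable (Z n) := fun n =>
    (hπ n).measurable_comp fun σ => (twoSidedDescents σ : ℝ) / n
  have hsup : ∀ t, ExpGrowth.expGrowthSup (expMoment P Z t) = ((2 * L t : ℝ) : EReal) :=
    fun t => (tendsto_log_expMoment hπ t).limsup_eq
  have hinf : ∀ t, ExpGrowth.expGrowthInf (expMoment P Z t) = ((2 * L t : ℝ) : EReal) :=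
    fun t => (tendsto_log_expMoment hπ t).liminf_eq
  have hscale : ∀ (n : ℕ) (x : EReal), (((n : ℝ)⁻¹ : ℝ) : EReal) * x = x / (n : EReal) :=
    fun n x => by
      rw [mul_comm, EReal.div_eq_inv_mul, mul_comm, EReal.coe_inv, EReal.coe_natCast]
  refine ⟨hZ, fun B hB => ?_, fun B _ => ?_⟩
  · simp only [hscale]
    change _ ≤ ExpGrowth.expGrowthInf (fun n => P (Z n ⁻¹' B))
    apply EReal.neg_le_of_neg_le
    refine le_iInf₂ fun y hy => ?_
    apply EReal.neg_le_of_neg_le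
    by_cases hJ : J y = ⊤
    · simp [hJ]
    obtain ⟨t, ht⟩ := exists_hasDerivAt_of_mem_Ioo (mem_Ioo_of_J_ne_top hJ)
    refine le_trans ?_ (le_expGrowthInf_measure P hZ hsup hinf ht hB hy)
    rw [EReal.neg_le, ← EReal.coe_neg, neg_sub]
    exact le_J y t
  · simp only [hscale]
    change ExpGrowth.expGrowthSup (fun n => P (Z n ⁻¹' B)) ≤ _
    simp only [J_eq_iSup]
    exact expGrowthSup_measure_le P hZ hsup isCompact_Icc
      (fun n ω => twoSidedDescents_div_mem_Icc (π n ω)) B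

end DescentLDP

theorem corollary4p4 {Ω : Type*} [MeasurableSpace Ω] (P : Measure Ω) [IsProbabilityMeasure P]
    (π : (n : ℕ) → Ω → Equiv.Perm (Fin n))
    (hπ : ∀ n : ℕ, DescentLDP.IsUniformPermutation P (π n)) :
    DescentLDP.IsGoodRateFunction DescentLDP.J ∧
      DescentLDP.SatisfiesLDP P
        (fun (n : ℕ) (ω : Ω) => (DescentLDP.twoSidedDescents (π n ω) : ℝ) / (n : ℝ))
        DescentLDP.J :=
  ⟨DescentLDP.isGoodRateFunction_J, DescentLDP.satisfiesLDP_twoSidedDescents P hπ⟩
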